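/- Let $N'\ge 3$, $N=2N'+2$, and $s_k=\sin\frac{k\pi}{N}$. For $\alpha,\beta\in\mathbb R$ let $H^D_{\alpha,\beta}:\mathbb R^{N'}\to\mathbb R$ be the fourth order Birkhoff normal form, as a function of the actions $I=(I_1,\dots,I_{N'})$, of the FPU chain with $N'$ moving particles, Dirichlet boundary conditions and potential $V(x)=\frac12x^2-\frac{\alpha}{3!}x^3+\frac{\beta}{4!}x^4+\dots$, that is, $$H^D_{\alpha,\beta}(I)=2\sum_{k=1}^{N'}s_kI_k+\frac{1}{16(N'+1)}\sum_{k=1}^{N'}\bigl(\alpha^2+3(\beta-\alpha^2)s_k^2\bigr)I_k^2+\varepsilon\,\frac{\beta-\alpha^2}{32(N'+1)}I_{N/4}^2+\frac{\beta-\alpha^2}{16(N'+1)}\Bigl(\sum_{\substack{1\le l,m\le N'\\ l\ne m}}4s_ls_mI_lI_m-\sum_{k=1}^{N'}s_{2k}I_kI_{N'+1-k}\Bigr),$$ where $\varepsilon=1$ if $N/4$ is an integer, and otherwise $\varepsilon=0$ (the term with $I_{N/4}$ is absent). Let $Q^D_{\alpha,\beta}$ be the Hessian of $H^D_{\alpha,\beta}$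 at $I=0$, a symmetric $N'\times N'$ matrix, and let its index be the number of its negative eigenvalues, counted with multiplicity. (i) Let $\alpha\in\mathbb R\setminus\{0\}$. Then $\det Q^D_{\alpha,\beta}$ is a polynomial in $\beta$ of degree $N'$ and has $N'$ real zeroes, counted with multiplicities. Listed in increasing order, the zeroes $\beta_k=\beta_k(\alpha)$ satisfy $$\beta_1\le\dots\le\beta_{\lceil (N'+1)/2\rceil}<\alpha^2<\beta_{\lceil (N'+3)/2\rceil}\le\dots\le\beta_{N'}.$$ Moreover, the index of $Q^D_{\alpha,\beta}$ is $\lceil\frac{N'+1}{2}\rceil$ for $\beta<\beta_1$; it is $0$ for $\beta_{\lceil (N'+1)/2\rceil}<\beta<\beta_{\lceil (N'+3)/2\rceil}$; and it is $\lfloor\frac{N'-1}{2}\rfloor$ for $\beta>\beta_{N'}$. (ii) For $\alpha=0$, $\det Q^D_{0,\beta}$ is a polynomial in $\beta$ of degree $N'$, and $\beta=0$ is its only zero. It has multiplicity $N'$, and the index of $Q^D_{0,\beta}$ is $\lceil\frac{N'+1}{2}\rceil$ for $\beta<0$ and $\lfloor\frac{N'-1}{2}\rfloor$ for $\beta>0$.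 -/

import Mathlib

open scoped Polynomial BigOperators

noncomputable section

/-- `s_k = sin (k π / N)` with `N = 2 n + 2`, where `n` is the number of moving particles. -/
def fpuSin (n k : ℕ) : ℝ := Real.sin ((k : ℝ) * Real.pi / (2 * (n : ℝ) + 2))

/-- The fourth order Birkhoff normal form, as a function of the actions `(I_1, …, I_n)`, of the
FPU chain with `n` moving particles and Dirichlet boundary conditions.
The action `I_k` (`1 ≤ k ≤ n`) is `I j` with `k = j + 1`; in particular `I_{n + 1 - k}` is
`I j.rev`. The third sum below is the term in `I_{N/4} ^ 2`, `N = 2 n + 2`, which is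
present only if `N / 4` is an integer (otherwise that sum is empty). -/
def dirichletBNF (n : ℕ) (α β : ℝ) (I : Fin n → ℝ) : ℝ :=
  2 * ∑ j : Fin n, fpuSin n ((j : ℕ) + 1) * I j
    + 1 / (16 * ((n : ℝ) + 1)) *
        ∑ j : Fin n, (α ^ 2 + 3 * (β - α ^ 2) * fpuSin n ((j : ℕ) + 1) ^ 2) * I j ^ 2
    + (β - α ^ 2) / (32 * ((n : ℝ) + 1)) *
        ∑ j ∈ Finset.univ.filter (fun j : Fin n => 4 * ((j : ℕ) + 1) = 2 * n + 2), I j ^ 2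
    + (β - α ^ 2) / (16 * ((n : ℝ) + 1)) *
        ((∑ l : Fin n, ∑ m ∈ Finset.univ.filter (fun m : Fin n => l ≠ m),
            4 * fpuSin n ((l : ℕ) + 1) * fpuSin n ((m : ℕ) + 1) * I l * I m)
          - ∑ j : Fin n, fpuSin n (2 * ((j : ℕ) + 1)) * I j * I j.rev)

/-- The Hessian matrix of `f : ℝⁿ → ℝ` at `x`: its `(i, j)` entry is the iterated partial
derivative `∂_i ∂_j f (x)`. -/
def hessianMatrix {n : ℕ} (f : (Fin n → ℝ) → ℝ) (x : Fin n → ℝ) : Matrix (Fin n) (Fin n) ℝ :=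
  Matrix.of fun i j =>
    fderiv ℝ (fun y => fderiv ℝ f y (Pi.single j 1)) x (Pi.single i 1)

/-- The Hessian at `I = 0` of the Birkhoff normal form of the Dirichlet chain. -/
def dirichletHessian (n : ℕ) (α β : ℝ) : Matrix (Fin n) (Fin n) ℝ :=
  hessianMatrix (dirichletBNF n α β) 0

/-- The index of a (symmetric) real matrix: the number of its negative eigenvalues, counted with
multiplicity. -/
def matrixIndex {n : ℕ} (A : Matrix (Fin n) (Fin n) ℝ) : ℕ :=
  (A.charpoly.roots.filter (fun x => x < 0)).card

end

open Matrix

noncomputable section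

/-! The Hessian is an affine pencil `c (α² 1 + (β - α²) C)` with `c = 1 / (8 (n + 1)) > 0` and `C =
chainMatrix n` independent of `α` and `β` (`dirichletHessian_eq`). In an orthonormal eigenbasis of
`C`, with eigenvalues `μ i`, its eigenvalues are `c (α² + (β - α²) μ i)`. If every `μ i ≠ 0`, this
is `c μ i (β - r i)` with `r i = α² (1 - 1 / μ i)`. For `α ≠ 0` the zero `r i` lies below `α²`
exactly when `μ i > 0`; for `α = 0` all zeroes are `0`. Everything thus follows from the signs of
the `μ i`.

In the coordinates `y j = s j * x j`, the form of `C` is negative definite on symmetric `y` of sum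
zero, and positive definite where `y j + y j.rev` is constant in `j`. These subspaces are cut out by
`n / 2 + 1` and `(n - 1) / 2` equations, which bound the numbers of nonnegative and of nonpositive
`μ i`. The bounds add up to `n`, so both are sharp and no `μ i` vanishes (`chainMatrix_inertia`). -/

/-- The Hessian of a quadratic polynomial is the symmetrization of its coefficient matrix. -/
theorem hessianMatrix_quadratic {n : ℕ} (ℓ : Fin n → ℝ) (A : Matrix (Fin n) (Fin n) ℝ)
    (x : Fin n → ℝ) :
    hessianMatrix (fun y => ∑ i, ℓ i * y i + ∑ i, ∑ j, A i j * y i * y j) x = A + Aᵀ := by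
  have h1 : ∀ y : Fin n → ℝ, ∀ j : Fin n,
      fderiv ℝ (fun y : Fin n → ℝ => ∑ i, ℓ i * y i + ∑ i, ∑ j, A i j * y i * y j) y
        (Pi.single j 1) = ℓ j + ∑ i, (A i j + A j i) * y i := by
    intro y j
    have hp : ∀ i, HasFDerivAt (fun y : Fin n → ℝ => y i)
        (ContinuousLinearMap.proj (R := ℝ) (φ := fun _ : Fin n => ℝ) i) y :=
      fun i => hasFDerivAt_apply i y
    have hd := (HasFDerivAt.fun_sum (u := Finset.univ) fun i _ => (hp i).const_mul (ℓ i)).add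
      (HasFDerivAt.fun_sum (u := Finset.univ) fun i _ =>
        HasFDerivAt.fun_sum (u := Finset.univ) fun k _ => ((hp i).const_mul (A i k)).mul (hp k))
    have hd' := hd.fderiv
    erw [hd']
    simp [Pi.single_apply, Finset.sum_add_distrib, mul_comm]
    simp only [mul_add, mul_comm, Finset.sum_add_distrib]
  have h2 : ∀ i j : Fin n,
      fderiv ℝ (fun y : Fin n → ℝ => ℓ j + ∑ i, (A i j + A j i) * y i) x (Pi.single i 1)
        = A i j + A j i := by
    intro i j
    have hd := (HasFDerivAt.fun_sum (u := Finset.univ) fun i _ =>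
      (hasFDerivAt_apply (𝕜 := ℝ) i x).const_mul (A i j + A j i)).const_add (ℓ j)
    have hd' := hd.fderiv
    erw [hd']
    simp [Pi.single_apply]
  ext i j
  simp only [hessianMatrix, Matrix.of_apply, h1, h2, Matrix.add_apply, Matrix.transpose_apply]

/-! ### The Hessian as an affine pencil in `β` -/

/-- The matrix governing the `β`-dependence of the Hessian of the Dirichlet chain. -/
def chainMatrix (n : ℕ) : Matrix (Fin n) (Fin n) ℝ :=
  Matrix.of fun l m => fpuSin n ((l : ℕ) + 1) * fpuSin n ((m : ℕ) + 1) *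
    (4 - (if l = m then 1 else 0) - 2 * (if m = l.rev then 1 else 0)
      + (if l = m ∧ m = l.rev then 1 else 0))

theorem fpuSin_pos {n : ℕ} (j : Fin n) : 0 < fpuSin n ((j : ℕ) + 1) := by
  have hj : ((j : ℕ) : ℝ) + 1 ≤ n := by exact_mod_cast j.isLt
  apply Real.sin_pos_of_pos_of_lt_pi
  · positivity
  · rw [div_lt_iff₀ (by positivity)]
    push_cast
    nlinarith [Real.pi_pos]

/-- The angles at `j` and `j.rev` add up to `π / 2`, so reversal turns sine into cosine and this is
the double-angle formula. -/
theorem fpuSin_two_mul {n : ℕ} (j : Fin n) :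
    fpuSin n (2 * ((j : ℕ) + 1)) = 2 * fpuSin n ((j : ℕ) + 1) * fpuSin n ((j.rev : ℕ) + 1) := by
  have hj : ((j.rev : ℕ) : ℝ) = n - (j + 1) := by
    rw [Fin.val_rev, Nat.cast_sub j.isLt]; push_cast; ring
  have hc : fpuSin n ((j.rev : ℕ) + 1) = Real.cos (((j : ℝ) + 1) * Real.pi / (2 * n + 2)) := by
    rw [fpuSin, ← Real.sin_pi_div_two_sub]
    congr 1
    push_cast
    rw [hj]
    field_simp
    ring
  rw [hc, fpuSin, fpuSin]
  push_cast
  rw [← Real.sin_two_mul]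
  congr 1
  ring

theorem fpuSin_sq_of_eq_rev {n : ℕ} {j : Fin n} (h : j = j.rev) :
    fpuSin n ((j : ℕ) + 1) ^ 2 = 1 / 2 := by
  have h2 : 2 * (j : ℕ) + 1 = n := by
    have := congrArg Fin.val h
    rw [Fin.val_rev] at this
    omega
  have h3 := fpuSin_two_mul j
  rw [← h] at h3
  have h4 : fpuSin n (2 * ((j : ℕ) + 1)) = 1 := by
    rw [fpuSin, ← Real.sin_pi_div_two]
    congr 1
    have : (n : ℝ) = 2 * j + 1 := by exact_mod_cast h2.symm
    push_cast
    rw [this]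
    field_simp
    ring
  rw [h4] at h3
  linarith

theorem four_mul_eq_iff_eq_rev {n : ℕ} (j : Fin n) :
    4 * ((j : ℕ) + 1) = 2 * n + 2 ↔ j = j.rev := by
  rw [Fin.ext_iff, Fin.val_rev]
  omega

/-- By the double-angle formula the antidiagonal coefficients also carry the factor `s l * s m`.
Only the resonant term in `I_{N/4}` lacks it; there `s ^ 2 = 1 / 2` supplies it. -/
theorem dirichletHessian_eq (n : ℕ) (α β : ℝ) :
    dirichletHessian n α β = (1 / (8 * ((n : ℝ) + 1))) •
      (α ^ 2 • (1 : Matrix (Fin n) (Fin n) ℝ) + (β - α ^ 2) • chainMatrix n) := by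
  set s : Fin n → ℝ := fun j => fpuSin n ((j : ℕ) + 1) with hs
  set A : Matrix (Fin n) (Fin n) ℝ := Matrix.of fun l m =>
    1 / (16 * ((n : ℝ) + 1)) * (if l = m then α ^ 2 + 3 * (β - α ^ 2) * s l ^ 2 else 0)
    + (β - α ^ 2) / (32 * ((n : ℝ) + 1)) * (if l = m then (if l = l.rev then 1 else 0) else 0)
    + (β - α ^ 2) / (16 * ((n : ℝ) + 1)) * ((if l ≠ m then 4 * s l * s m else 0)
      - (if m = l.rev then 2 * s l * s l.rev else 0)) with hA
  have hf : dirichletBNF n α β = fun y => ∑ i, (2 * s i) * y i + ∑ i, ∑ j, A i j * y i * y j := by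
    funext y
    have hrow : ∀ i, ∑ j, A i j * y i * y j =
        1 / (16 * ((n : ℝ) + 1)) * ((α ^ 2 + 3 * (β - α ^ 2) * s i ^ 2) * y i ^ 2)
        + (β - α ^ 2) / (32 * ((n : ℝ) + 1)) * (if i = i.rev then y i ^ 2 else 0)
        + (β - α ^ 2) / (16 * ((n : ℝ) + 1)) *
          ((∑ m, if i ≠ m then 4 * s i * s m * y i * y m else 0)
            - 2 * s i * s i.rev * y i * y i.rev) := by
      intro i
      have hent : ∀ j, A i j * y i * y j =
          (if i = j then 1 / (16 * ((n : ℝ) + 1)) *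
            ((α ^ 2 + 3 * (β - α ^ 2) * s i ^ 2) * y i ^ 2) else 0)
          + (if i = j then (β - α ^ 2) / (32 * ((n : ℝ) + 1)) *
            (if i = i.rev then y i ^ 2 else 0) else 0)
          + (β - α ^ 2) / (16 * ((n : ℝ) + 1)) *
            ((if i ≠ j then 4 * s i * s j * y i * y j else 0)
              - (if j = i.rev then 2 * s i * s i.rev * y i * y i.rev else 0)) := by
        intro j
        simp only [hA, Matrix.of_apply]
        by_cases h1 : i = j
        · subst h1
          by_cases h2 : i = i.rev
          · rw [← h2]
            simp
            ring
          · simp [h2]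
            ring
        · by_cases h2 : j = i.rev
          · subst h2
            simp [h1]
            ring
          · simp [h1, h2]
            ring
      simp only [hent, Finset.sum_add_distrib, ← Finset.mul_sum, Finset.sum_sub_distrib,
        Finset.sum_ite_eq, Finset.sum_ite_eq', Finset.mem_univ, if_true]
    simp only [hrow]
    simp only [Finset.sum_add_distrib, ← Finset.mul_sum, Finset.sum_sub_distrib,
      dirichletBNF, fpuSin_two_mul, Finset.sum_filter, four_mul_eq_iff_eq_rev, hs, mul_assoc, ← mul_ite_zero]
    ring
  rw [dirichletHessian, hf, hessianMatrix_quadratic]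
  ext l m
  have hn : (n : ℝ) + 1 ≠ 0 := by positivity
  simp only [hA, chainMatrix, Matrix.add_apply, Matrix.of_apply, Matrix.transpose_apply,
    Matrix.smul_apply, Matrix.one_apply, smul_eq_mul]
  change _ = 1 / (8 * ((n : ℝ) + 1)) * (α ^ 2 * _ + (β - α ^ 2) * (s l * s m * _))
  by_cases hlm : l = m
  · subst hlm
    by_cases hr : l = l.rev
    · have hq : s l ^ 2 = 1 / 2 := fpuSin_sq_of_eq_rev hr
      rw [← hr]
      simp only [if_true, ne_eq, not_true_eq_false, if_false, and_self]
      field_simp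
      linear_combination (512 * (α ^ 2 - β)) * hq
    · simp only [if_true, ne_eq, not_true_eq_false, if_false, hr, and_false]
      field_simp
      ring
  · have hml : ¬ m = l := fun h => hlm h.symm
    by_cases hr : m = l.rev
    · have hr' : l = m.rev := by rw [hr, Fin.rev_rev]
      rw [← hr, ← hr']
      simp only [if_true, ne_eq, not_false_eq_true, if_false, hlm, hml, false_and]
      field_simp
      ring
    · have hr' : ¬ l = m.rev := fun h => hr (by rw [h, Fin.rev_rev])
      simp only [if_true, ne_eq, not_false_eq_true, if_false, hlm, hml, hr, hr', false_and]
      field_simp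
      ring

/-! ### Counting eigenvalue signs by test subspaces -/

/-- If a real quadratic form, diagonal with entries `μ` in an orthonormal basis, is negative on
the nonzero kernel vectors of a map of rank at most `m`, then at most `m` of the `μ i` are
nonnegative. -/
theorem card_nonneg_le_of_neg_on_ker {n m : ℕ} {A U : Matrix (Fin n) (Fin n) ℝ} {μ : Fin n → ℝ}
    (hU : Uᵀ * U = 1) (hA : A = U * diagonal μ * Uᵀ)
    (f : (Fin n → ℝ) →ₗ[ℝ] (Fin m → ℝ))
    (hf : ∀ x, f x = 0 → x ≠ 0 → x ⬝ᵥ A *ᵥ x < 0) :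
    (Finset.univ.filter fun i => 0 ≤ μ i).card ≤ m := by
  set S := {i : Fin n // 0 ≤ μ i}
  let e : (S → ℝ) →ₗ[ℝ] (Fin n → ℝ) :=
    Function.ExtendByZero.linearMap ℝ (Subtype.val : S → Fin n)
  have he : ∀ c : S → ℝ, ∀ i : S, e c i = c i := fun c i =>
    Subtype.val_injective.extend_apply c 0 i
  have he0 : ∀ c : S → ℝ, ∀ i : Fin n, ¬ 0 ≤ μ i → e c i = 0 := by
    intro c i hi
    exact Function.extend_apply' (f := (Subtype.val : S → Fin n)) c 0 i (by rintro ⟨a, rfl⟩; exact hi a.2)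
  let g : (S → ℝ) →ₗ[ℝ] (Fin m → ℝ) := f ∘ₗ U.mulVecLin ∘ₗ e
  -- On the span of the eigenvectors with `0 ≤ μ i` the form is nonnegative, so this span meets the
  -- kernel of `f` only in `0`.
  have hg : Function.Injective g := by
    rw [injective_iff_map_eq_zero]
    intro c hc
    have hform : (U *ᵥ e c) ⬝ᵥ A *ᵥ (U *ᵥ e c) = ∑ i, μ i * e c i ^ 2 := by
      have h1 : A *ᵥ (U *ᵥ e c) = U *ᵥ (diagonal μ *ᵥ e c) := by
        rw [hA, Matrix.mulVec_mulVec, Matrix.mul_assoc, hU, Matrix.mul_one, Matrix.mulVec_mulVec]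
      rw [h1, Matrix.dotProduct_mulVec, ← Matrix.mulVec_transpose, Matrix.mulVec_mulVec, hU,
        Matrix.one_mulVec, dotProduct]
      refine Finset.sum_congr rfl fun i _ => ?_
      rw [Matrix.mulVec_diagonal]
      ring
    have h0 : U *ᵥ e c = 0 := by
      by_contra hne
      have hlt := hf (U *ᵥ e c) hc hne
      rw [hform] at hlt
      refine absurd hlt (not_lt.mpr (Finset.sum_nonneg fun i _ => ?_))
      by_cases hi : 0 ≤ μ i
      · positivity
      · rw [he0 c i hi]; simp
    have h2 : e c = 0 := by
      rw [← Matrix.one_mulVec (e c), ← hU, ← Matrix.mulVec_mulVec, h0, Matrix.mulVec_zero]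
    funext i
    rw [← he c i, h2]
    rfl
  have := LinearMap.finrank_le_finrank_of_injective hg
  rwa [Module.finrank_fintype_fun_eq_card, Module.finrank_fintype_fun_eq_card, Fintype.card_fin,
    Fintype.card_subtype] at this

/-! ### Definite subspaces and inertia of the chain matrix -/

theorem chainMatrix_isSymm (n : ℕ) : (chainMatrix n)ᵀ = chainMatrix n := by
  ext l m
  have h : l = m.rev ↔ m = l.rev := ⟨fun h => by rw [h, Fin.rev_rev], fun h => by rw [h, Fin.rev_rev]⟩
  simp only [chainMatrix, Matrix.transpose_apply, Matrix.of_apply, h, @eq_comm _ m l]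
  by_cases hl : l = m
  · subst hl; simp
  · simp only [hl, false_and, if_false]
    ring

theorem chainMatrix_form (n : ℕ) (x : Fin n → ℝ) (y : Fin n → ℝ)
    (hy : ∀ j, y j = fpuSin n ((j : ℕ) + 1) * x j) :
    x ⬝ᵥ chainMatrix n *ᵥ x = 4 * (∑ j, y j) ^ 2 - ∑ j, y j ^ 2 - 2 * ∑ j, y j * y j.rev
      + ∑ j, (if j = j.rev then y j ^ 2 else 0) := by
  have hrow : ∀ l, x l * (chainMatrix n *ᵥ x) l = 4 * (y l * ∑ j, y j) - y l ^ 2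
      - 2 * (y l * y l.rev) + (if l = l.rev then y l ^ 2 else 0) := by
    intro l
    have hent : ∀ m, x l * (chainMatrix n l m * x m) = 4 * y l * y m
        - (if l = m then y l ^ 2 else 0) - (if m = l.rev then 2 * (y l * y l.rev) else 0)
        + (if l = m then (if l = l.rev then y l ^ 2 else 0) else 0) := by
      intro m
      simp only [chainMatrix, Matrix.of_apply, hy]
      by_cases h1 : l = m
      · subst h1
        by_cases h2 : l = l.rev
        · rw [← h2]
          simp
          ring
        · simp [h2]
          ring
      · by_cases h2 : m = l.rev
        · subst h2
          simp [h1]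
          ring
        · simp [h1, h2]
          ring
    rw [Matrix.mulVec, dotProduct, Finset.mul_sum]
    simp only [hent, Finset.sum_add_distrib, Finset.sum_sub_distrib, ← Finset.mul_sum,
        Finset.sum_ite_eq, Finset.sum_ite_eq', Finset.mem_univ, if_true]
    ring
  rw [dotProduct]
  simp only [hrow, Finset.sum_add_distrib, Finset.sum_sub_distrib, ← Finset.mul_sum,
    ← Finset.sum_mul]
  ring

/-- Symmetry turns the reversal term into `-2 ∑ y j ^ 2`, and the middle term gives back at most `∑
y j ^ 2`, so the form is at most `-2 ∑ y j ^ 2`. -/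
theorem chainMatrix_neg_of_symm {n : ℕ} {x y : Fin n → ℝ}
    (hy : ∀ j, y j = fpuSin n ((j : ℕ) + 1) * x j) (hx : x ≠ 0)
    (hsymm : ∀ j, y j.rev = y j) (hsum : ∑ j, y j = 0) : x ⬝ᵥ chainMatrix n *ᵥ x < 0 := by
  rw [chainMatrix_form n x y hy, hsum]
  have h1 : ∑ j, y j * y j.rev = ∑ j, y j ^ 2 :=
    Finset.sum_congr rfl fun j _ => by rw [hsymm]; ring
  have h2 : ∑ j, (if j = j.rev then y j ^ 2 else 0) ≤ ∑ j, y j ^ 2 :=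
    Finset.sum_le_sum fun j _ => (ite_le_sup _ _ _).trans (by simp [sq_nonneg])
  have h3 : 0 < ∑ j, y j ^ 2 := by
    obtain ⟨j, hj⟩ := Function.ne_iff.mp hx
    refine Finset.sum_pos' (fun j _ => sq_nonneg _) ⟨j, Finset.mem_univ j, ?_⟩
    rw [hy]
    have := mul_ne_zero (fpuSin_pos j).ne' hj
    positivity
  rw [h1]
  linarith

/-- Here `y j.rev = 2 t - y j`, and the form becomes `4 n (n - 1) t ^ 2 + ∑ y j ^ 2` plus the
nonnegative middle term. -/
theorem chainMatrix_pos_of_add_rev {n : ℕ} {x y : Fin n → ℝ} {t : ℝ}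
    (hy : ∀ j, y j = fpuSin n ((j : ℕ) + 1) * x j) (hx : x ≠ 0)
    (hadd : ∀ j, y j + y j.rev = 2 * t) : 0 < x ⬝ᵥ chainMatrix n *ᵥ x := by
  rw [chainMatrix_form n x y hy]
  have hrev : ∑ j : Fin n, y j.rev = ∑ j, y j := Equiv.sum_comp Fin.revPerm y
  have hsum : ∑ j, y j = n * t := by
    have : ∑ j, (y j + y j.rev) = ∑ _j : Fin n, 2 * t := Finset.sum_congr rfl fun j _ => hadd j
    rw [Finset.sum_add_distrib, hrev] at this
    simp at this
    linarith
  have h1 : ∑ j, y j * y j.rev = 2 * t * (n * t) - ∑ j, y j ^ 2 := by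
    rw [← hsum, Finset.mul_sum, ← Finset.sum_sub_distrib]
    refine Finset.sum_congr rfl fun j _ => ?_
    rw [← hadd j]
    ring
  have h2 : 0 ≤ ∑ j, (if j = j.rev then y j ^ 2 else 0) :=
    Finset.sum_nonneg fun j _ => by split_ifs <;> positivity
  obtain ⟨j, hj⟩ := Function.ne_iff.mp hx
  have h3 : 0 < ∑ j, y j ^ 2 := by
    refine Finset.sum_pos' (fun j _ => sq_nonneg _) ⟨j, Finset.mem_univ j, ?_⟩
    rw [hy]
    have := mul_ne_zero (fpuSin_pos j).ne' hj
    positivity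
  have hn : (1 : ℝ) ≤ n := by exact_mod_cast (Nat.zero_le _).trans_lt j.isLt
  rw [h1, hsum]
  nlinarith [mul_nonneg (mul_nonneg (sub_nonneg.mpr hn) (by linarith : (0 : ℝ) ≤ n)) (sq_nonneg t)]

/-- The linear map whose kernel consists of the symmetric vectors of sum zero. -/
def symmMap (n : ℕ) (s : Fin n → ℝ) : (Fin n → ℝ) →ₗ[ℝ] (Fin (n / 2 + 1) → ℝ) where
  -- The first `n / 2` coordinates compare mirror pairs; the last one is the sum.
  toFun x k := if h : (k : ℕ) < n / 2 then
      s ⟨k, by omega⟩ * x ⟨k, by omega⟩ - s (Fin.rev ⟨k, by omega⟩) * x (Fin.rev ⟨k, by omega⟩)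
    else ∑ j, s j * x j
  map_add' x y := by
    funext k
    simp only [Pi.add_apply]
    split_ifs
    · ring
    · simp only [mul_add, Finset.sum_add_distrib]
  map_smul' c x := by
    funext k
    simp only [Pi.smul_apply, smul_eq_mul, RingHom.id_apply]
    split_ifs
    · ring
    · rw [Finset.mul_sum]
      exact Finset.sum_congr rfl fun j _ => by ring

/-- The linear map whose kernel consists of the vectors for which `y j + y j.rev` is constant. -/
def addRevMap (n : ℕ) (hn : 0 < n) (s : Fin n → ℝ) :
    (Fin n → ℝ) →ₗ[ℝ] (Fin ((n - 1) / 2) → ℝ) where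
  -- Pair `0` is the reference, hence the shift by one. For odd `n` the last pair is the middle
  -- index taken twice.
  toFun x k :=
    s ⟨k + 1, by omega⟩ * x ⟨k + 1, by omega⟩
      + s (Fin.rev ⟨k + 1, by omega⟩) * x (Fin.rev ⟨k + 1, by omega⟩)
      - (s ⟨0, hn⟩ * x ⟨0, hn⟩ + s (Fin.rev ⟨0, hn⟩) * x (Fin.rev ⟨0, hn⟩))
  map_add' x y := by
    funext k
    simp only [Pi.add_apply]
    ring
  map_smul' c x := by
    funext k
    simp only [Pi.smul_apply, smul_eq_mul, RingHom.id_apply]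
    ring

/-- A property of `Fin n` invariant under reversal holds if it holds on the first half. -/
theorem forall_of_rev {n : ℕ} {p : Fin n → Prop} (hp : ∀ j, p j → p j.rev)
    (h : ∀ j : Fin n, 2 * (j : ℕ) + 1 ≤ n → p j) (j : Fin n) : p j := by
  by_cases hj : 2 * (j : ℕ) + 1 ≤ n
  · exact h j hj
  · have := hp _ (h j.rev (by rw [Fin.val_rev]; omega))
    rwa [Fin.rev_rev] at this

theorem chainMatrix_card_nonneg_le {n : ℕ} {U : Matrix (Fin n) (Fin n) ℝ} {μ : Fin n → ℝ}
    (hU : Uᵀ * U = 1) (hA : chainMatrix n = U * diagonal μ * Uᵀ) :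
    (Finset.univ.filter fun i => 0 ≤ μ i).card ≤ n / 2 + 1 := by
  refine card_nonneg_le_of_neg_on_ker hU hA (symmMap n fun j => fpuSin n ((j : ℕ) + 1)) ?_
  intro x hx hx0
  refine chainMatrix_neg_of_symm (y := fun j => fpuSin n ((j : ℕ) + 1) * x j) (fun _ => rfl) hx0
    ?_ ?_
  · refine forall_of_rev (fun j hj => by rw [Fin.rev_rev, hj]) fun j hj => ?_
    by_cases h2 : (j : ℕ) < n / 2
    · have := congrFun hx ⟨j, by omega⟩
      simp only [symmMap, LinearMap.coe_mk, AddHom.coe_mk, h2, dif_pos, Pi.zero_apply,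
        Fin.eta] at this
      linarith
    · have : j.rev = j := by
        rw [Fin.ext_iff, Fin.val_rev]
        omega
      simp only [this]
  · have := congrFun hx ⟨n / 2, by omega⟩
    simpa [symmMap] using this

theorem chainMatrix_card_nonpos_le {n : ℕ} (hn : 0 < n) {U : Matrix (Fin n) (Fin n) ℝ}
    {μ : Fin n → ℝ} (hU : Uᵀ * U = 1) (hA : chainMatrix n = U * diagonal μ * Uᵀ) :
    (Finset.univ.filter fun i => μ i ≤ 0).card ≤ (n - 1) / 2 := by
  have hA' : -chainMatrix n = U * diagonal (fun i => -μ i) * Uᵀ := by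
    rw [hA, ← Matrix.neg_mul, ← Matrix.mul_neg, Matrix.diagonal_neg]
  have := card_nonneg_le_of_neg_on_ker hU hA' (addRevMap n hn fun j => fpuSin n ((j : ℕ) + 1)) ?_
  · simpa using this
  intro x hx hx0
  rw [Matrix.neg_mulVec, dotProduct_neg, neg_lt_zero]
  set y : Fin n → ℝ := fun j => fpuSin n ((j : ℕ) + 1) * x j with hy
  refine chainMatrix_pos_of_add_rev (y := y) (t := (y ⟨0, hn⟩ + y (Fin.rev ⟨0, hn⟩)) / 2)
    (fun _ => rfl) hx0 ?_
  refine forall_of_rev (fun j hj => by rw [Fin.rev_rev, ← hj, add_comm]) fun j hj => ?_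
  obtain ⟨j, hjn⟩ := j
  cases j with
  | zero => ring
  | succ k =>
    simp only at hj
    have := congrFun hx ⟨k, by omega⟩
    simp only [addRevMap, LinearMap.coe_mk, AddHom.coe_mk, Pi.zero_apply] at this
    simp only [hy]
    linarith

theorem exists_diagonalization {n : ℕ} {A : Matrix (Fin n) (Fin n) ℝ} (hA : Aᵀ = A) :
    ∃ (U : Matrix (Fin n) (Fin n) ℝ) (μ : Fin n → ℝ), Uᵀ * U = 1 ∧ A = U * diagonal μ * Uᵀ := by
  have h : A.IsHermitian := by
    rw [Matrix.IsHermitian, Matrix.conjTranspose_eq_transpose_of_trivial, hA]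
  refine ⟨h.eigenvectorUnitary, h.eigenvalues, ?_, ?_⟩
  · have := Unitary.coe_star_mul_self h.eigenvectorUnitary
    rwa [Matrix.star_eq_conjTranspose, Matrix.conjTranspose_eq_transpose_of_trivial] at this
  · have := h.spectral_theorem
    rw [Unitary.conjStarAlgAut_apply, Matrix.star_eq_conjTranspose,
      Matrix.conjTranspose_eq_transpose_of_trivial] at this
    exact this

/-- The inertia of the matrix `chainMatrix n`, together with a diagonalization. -/
theorem chainMatrix_inertia {n : ℕ} (hn : 0 < n) :
    ∃ (U : Matrix (Fin n) (Fin n) ℝ) (μ : Fin n → ℝ), Uᵀ * U = 1 ∧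
      chainMatrix n = U * diagonal μ * Uᵀ ∧ (∀ i, μ i ≠ 0) ∧
      (Finset.univ.filter fun i => 0 < μ i).card = n / 2 + 1 ∧
      (Finset.univ.filter fun i => μ i < 0).card = (n - 1) / 2 := by
  obtain ⟨U, μ, hU, hA⟩ := exists_diagonalization (chainMatrix_isSymm n)
  have h1 := chainMatrix_card_nonneg_le hU hA
  have h2 := chainMatrix_card_nonpos_le hn hU hA
  have h3 := Finset.card_filter_add_card_filter_not (s := Finset.univ) (fun i : Fin n => 0 < μ i)
  have h4 := Finset.card_filter_add_card_filter_not (s := Finset.univ) (fun i : Fin n => μ i < 0)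
  simp only [not_lt, Finset.card_univ, Fintype.card_fin] at h3 h4
  have h5 : (Finset.univ.filter fun i => 0 < μ i) ⊆ Finset.univ.filter fun i => 0 ≤ μ i :=
    Finset.monotone_filter_right _ fun i _ hi => le_of_lt hi
  have h6 := Finset.card_le_card h5
  -- `n / 2 + 1 + (n - 1) / 2 = n` forces equality in both bounds, so "positive" and "nonnegative"
  -- select the same indices.
  refine ⟨U, μ, hU, hA, fun i hi => ?_, by omega, by omega⟩
  have h7 := Finset.eq_of_subset_of_card_le h5 (by omega)
  have : i ∈ Finset.univ.filter fun i => 0 < μ i := by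
    rw [h7]
    simp [hi]
  simp [hi] at this

/-! ### Index and determinant from a diagonalization -/

theorem charpoly_eq_of_diagonalization {n : ℕ} {A U : Matrix (Fin n) (Fin n) ℝ} {ν : Fin n → ℝ}
    (hU : Uᵀ * U = 1) (hA : A = U * diagonal ν * Uᵀ) :
    A.charpoly = ∏ i, (Polynomial.X - Polynomial.C (ν i)) := by
  rw [hA, Matrix.charpoly_mul_comm, ← Matrix.mul_assoc, hU, Matrix.one_mul,
    Matrix.charpoly_diagonal]

theorem matrixIndex_of_diagonalization {n : ℕ} {A U : Matrix (Fin n) (Fin n) ℝ} {ν : Fin n → ℝ}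
    (hU : Uᵀ * U = 1) (hA : A = U * diagonal ν * Uᵀ) :
    matrixIndex A = (Finset.univ.filter fun i => ν i < 0).card := by
  have : (∏ i, (Polynomial.X - Polynomial.C (ν i))).roots = Finset.univ.val.map ν := by
    rw [← Polynomial.roots_multiset_prod_X_sub_C (Finset.univ.val.map ν), Multiset.map_map]
    rfl
  rw [matrixIndex, charpoly_eq_of_diagonalization hU hA, this, Multiset.filter_map,
    Multiset.card_map]
  rfl

theorem det_of_diagonalization {n : ℕ} {A U : Matrix (Fin n) (Fin n) ℝ} {ν : Fin n → ℝ}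
    (hU : Uᵀ * U = 1) (hA : A = U * diagonal ν * Uᵀ) : A.det = ∏ i, ν i := by
  rw [hA, Matrix.det_mul_comm, ← Matrix.mul_assoc, hU, Matrix.one_mul, Matrix.det_diagonal]

theorem dirichletHessian_diagonalization {n : ℕ} {U : Matrix (Fin n) (Fin n) ℝ} {μ : Fin n → ℝ}
    (hU : Uᵀ * U = 1) (hA : chainMatrix n = U * diagonal μ * Uᵀ) (α β : ℝ) :
    dirichletHessian n α β = U * diagonal
      (fun i => 1 / (8 * ((n : ℝ) + 1)) * (α ^ 2 + (β - α ^ 2) * μ i)) * Uᵀ := by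
  have hd : diagonal (fun i => 1 / (8 * ((n : ℝ) + 1)) * (α ^ 2 + (β - α ^ 2) * μ i)) =
      (1 / (8 * ((n : ℝ) + 1))) • (α ^ 2 • (1 : Matrix (Fin n) (Fin n) ℝ)
        + (β - α ^ 2) • diagonal μ) := by
    ext i j
    by_cases h : i = j
    · subst h; simp
    · simp [h]
  rw [dirichletHessian_eq, hd, hA]
  simp only [Matrix.mul_add, Matrix.add_mul, Matrix.mul_smul, Matrix.smul_mul, Matrix.mul_one,
    mul_eq_one_comm.mp hU]

/-! ### Rounding and ordered listing of the zeroes -/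

theorem ceil_succ_div_two (n : ℕ) : ⌈((n : ℝ) + 1) / 2⌉₊ = n / 2 + 1 := by
  rw [Nat.ceil_eq_iff (by omega), Nat.add_sub_cancel]
  have h1 : 2 * (n / 2) ≤ n := by omega
  have h2 : n ≤ 2 * (n / 2) + 1 := by omega
  have h1' : (2 : ℝ) * ((n / 2 : ℕ) : ℝ) ≤ n := by exact_mod_cast h1
  have h2' : (n : ℝ) ≤ 2 * ((n / 2 : ℕ) : ℝ) + 1 := by exact_mod_cast h2
  push_cast at *
  constructor <;> linarith

theorem ceil_add_three_div_two (n : ℕ) : ⌈((n : ℝ) + 3) / 2⌉₊ = n / 2 + 2 := by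
  have h : ((n : ℝ) + 3) / 2 = ((n + 2 : ℕ) + 1) / 2 := by push_cast; ring
  rw [h, ceil_succ_div_two]
  omega

theorem floor_pred_div_two {n : ℕ} (hn : 0 < n) : ⌊((n : ℝ) - 1) / 2⌋₊ = (n - 1) / 2 := by
  have h : ((n : ℝ) - 1) / 2 = ((n - 1 : ℕ) : ℝ) / (2 : ℕ) := by
    rw [Nat.cast_sub hn]; push_cast; ring
  rw [h, Nat.floor_div_natCast, Nat.floor_natCast]

/-- A finite family of reals, listed in increasing order with indices `1, …, n`. -/
theorem exists_increasing_enumeration {n : ℕ} (hn : 0 < n) (r : Fin n → ℝ) :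
    ∃ b : ℕ → ℝ, Monotone b ∧ Finset.univ.val.map r = (Finset.Icc 1 n).val.map b ∧
      (∀ a : ℝ, ∀ k, 1 ≤ k → k ≤ n →
        (k ≤ (Finset.univ.filter fun i => r i < a).card ↔ b k < a)) ∧
      ∀ i, ∃ k, 1 ≤ k ∧ k ≤ n ∧ b k = r i := by
  set g := r ∘ Tuple.sort r with hg
  have hmono : Monotone g := Tuple.monotone_sort r
  have hb : ∀ k, ∀ h : k < n, g ⟨min (k + 1 - 1) (n - 1), by omega⟩ = g ⟨k, h⟩ := by
    intro k h
    congr 2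
    omega
  -- Indices start at `1`; clamping to the range keeps the sequence monotone on all of `ℕ`.
  refine ⟨fun k => g ⟨min (k - 1) (n - 1), by omega⟩, fun k l hkl => hmono ?_, ?_, ?_, ?_⟩
  · rw [Fin.mk_le_mk]; omega
  · have h1 : Finset.univ.val.map r = Finset.univ.val.map g := by
      rw [hg, ← Multiset.map_map]
      congr 1
      exact (congrArg Finset.val (Finset.map_univ_equiv (Tuple.sort r))).symm
    have hinj : Function.Injective fun i : Fin n => (i : ℕ) + 1 :=
      fun i j h => Fin.ext (Nat.succ_injective h)
    have h2 : Finset.Icc 1 n = Finset.univ.map ⟨_, hinj⟩ := by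
      ext k
      simp only [Finset.mem_Icc, Finset.mem_map, Finset.mem_univ, true_and,
        Function.Embedding.coeFn_mk]
      constructor
      · rintro ⟨h, h'⟩
        exact ⟨⟨k - 1, by omega⟩, Nat.sub_add_cancel h⟩
      · rintro ⟨i, rfl⟩
        exact ⟨Nat.succ_le_succ (Nat.zero_le _), i.isLt⟩
    rw [h1, h2, Finset.map_val, Multiset.map_map]
    exact Multiset.map_congr rfl fun i _ => (hb i i.isLt).symm
  · intro a k hk hkn
    obtain ⟨k, rfl⟩ := Nat.exists_eq_add_of_le' hk
    simp only [hb k hkn]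
    rw [← Tuple.lt_card_lt_iff_apply_lt_of_monotone hmono]
    have : (Finset.univ.filter fun i => g i < a).card
        = (Finset.univ.filter fun i => r i < a).card := by
      refine Finset.card_equiv (Tuple.sort r) fun i => ?_
      simp [hg]
    rw [this]
    exact Nat.succ_le_iff
  · intro i
    refine ⟨(Tuple.sort r).symm i + 1, by omega, ((Tuple.sort r).symm i).isLt, ?_⟩
    simp only [hb _ ((Tuple.sort r).symm i).isLt]
    simp [hg]

theorem mul_mul_neg_iff_of_neg_right {c m t : ℝ} (hc : 0 < c) (ht : t < 0) :
    c * m * t < 0 ↔ 0 < m := by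
  rw [← neg_pos, ← mul_neg, mul_pos_iff_of_pos_right (neg_pos.mpr ht), mul_pos_iff_of_pos_left hc]

theorem mul_mul_neg_iff_of_pos_right {c m t : ℝ} (hc : 0 < c) (ht : 0 < t) :
    c * m * t < 0 ↔ m < 0 := by
  rw [← neg_pos, ← neg_mul, ← mul_neg, mul_pos_iff_of_pos_right ht, mul_pos_iff_of_pos_left hc,
    neg_pos]

end

/-! ### The two cases `α ≠ 0` and `α = 0` -/

theorem mainTheorem5 (n : ℕ) (hn : 3 ≤ n) :
    (∀ α : ℝ, α ≠ 0 →
      ∃ p : ℝ[X], (∀ β : ℝ, (dirichletHessian n α β).det = p.eval β) ∧ p.degree = n ∧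
        ∃ b : ℕ → ℝ,
          MonotoneOn b (Set.Icc 1 n) ∧
          p.roots = (Finset.Icc 1 n).val.map b ∧
          b ⌈((n : ℝ) + 1) / 2⌉₊ < α ^ 2 ∧
          α ^ 2 < b ⌈((n : ℝ) + 3) / 2⌉₊ ∧
          (∀ β : ℝ, β < b 1 →
            matrixIndex (dirichletHessian n α β) = ⌈((n : ℝ) + 1) / 2⌉₊) ∧
          (∀ β : ℝ, b ⌈((n : ℝ) + 1) / 2⌉₊ < β → β < b ⌈((n : ℝ) + 3) / 2⌉₊ →
            matrixIndex (dirichletHessian n α β) = 0) ∧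
          (∀ β : ℝ, b n < β →
            matrixIndex (dirichletHessian n α β) = ⌊((n : ℝ) - 1) / 2⌋₊)) ∧
    (∃ p : ℝ[X], (∀ β : ℝ, (dirichletHessian n 0 β).det = p.eval β) ∧ p.degree = n ∧
      (∀ β : ℝ, (dirichletHessian n 0 β).det = 0 ↔ β = 0) ∧
      p.rootMultiplicity 0 = n ∧
      (∀ β : ℝ, β < 0 →
        matrixIndex (dirichletHessian n 0 β) = ⌈((n : ℝ) + 1) / 2⌉₊) ∧
      (∀ β : ℝ, 0 < β →
        matrixIndex (dirichletHessian n 0 β) = ⌊((n : ℝ) - 1) / 2⌋₊)) := by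
  have hn0 : 0 < n := by omega
  rw [ceil_succ_div_two, ceil_add_three_div_two, floor_pred_div_two hn0]
  obtain ⟨U, μ, hU, hA, hμ, hpos, hneg⟩ := chainMatrix_inertia hn0
  have hdiag := dirichletHessian_diagonalization hU hA
  have hc : 0 < 1 / (8 * ((n : ℝ) + 1)) := by positivity
  set c := 1 / (8 * ((n : ℝ) + 1))
  -- This is the leading coefficient of the determinant in `β`, so the degree is exactly `n`.
  have hlead : (∏ i, c * μ i) ≠ 0 := Finset.prod_ne_zero_iff.mpr fun i _ =>
    mul_ne_zero hc.ne' (hμ i)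
  have hindex : ∀ α β, matrixIndex (dirichletHessian n α β) =
      (Finset.univ.filter fun i => c * (α ^ 2 + (β - α ^ 2) * μ i) < 0).card := fun α β =>
    matrixIndex_of_diagonalization hU (hdiag α β)
  constructor
  · intro α hα
    have hα2 : 0 < α ^ 2 := by positivity
    set r : Fin n → ℝ := fun i => α ^ 2 - α ^ 2 / μ i with hr
    have hν : ∀ β i, c * (α ^ 2 + (β - α ^ 2) * μ i) = c * μ i * (β - r i) := by
      intro β i
      have := hμ i
      simp only [hr]
      field_simp
      ring
    have hr_lt : ∀ i, r i < α ^ 2 ↔ 0 < μ i := by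
      intro i
      simp only [hr]
      rw [sub_lt_self_iff, div_eq_mul_inv, mul_pos_iff_of_pos_left hα2, inv_pos]
    have hr_gt : ∀ i, μ i < 0 → α ^ 2 < r i := by
      intro i hi
      have := div_neg_of_pos_of_neg hα2 hi
      simp only [hr]
      linarith
    replace hindex : ∀ β, matrixIndex (dirichletHessian n α β) =
        (Finset.univ.filter fun i => c * μ i * (β - r i) < 0).card := by
      intro β
      rw [hindex]
      simp only [hν]
    have hsign_of_lt : ∀ β i, β < r i → (c * μ i * (β - r i) < 0 ↔ 0 < μ i) := by
      intro β i h
      rw [mul_mul_neg_iff_of_neg_right hc (sub_neg.mpr h)]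
    have hsign_of_gt : ∀ β i, r i < β → (c * μ i * (β - r i) < 0 ↔ μ i < 0) := by
      intro β i h
      rw [mul_mul_neg_iff_of_pos_right hc (sub_pos.mpr h)]
    obtain ⟨b, hbmono, hbroots, hblt, hbr⟩ := exists_increasing_enumeration hn0 r
    have hcard : (Finset.univ.filter fun i => r i < α ^ 2).card = n / 2 + 1 := by
      simp only [hr_lt, hpos]
    have hroots : (∏ i, (Polynomial.X - Polynomial.C (r i))).roots = Finset.univ.val.map r := by
      rw [← Polynomial.roots_multiset_prod_X_sub_C (Finset.univ.val.map r), Multiset.map_map]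
      rfl
    refine ⟨Polynomial.C (∏ i, c * μ i) * ∏ i, (Polynomial.X - Polynomial.C (r i)), ?_, ?_, b,
      hbmono.monotoneOn _, ?_, ?_, ?_, ?_, ?_, ?_⟩
    · intro β
      rw [det_of_diagonalization hU (hdiag α β), Polynomial.eval_mul, Polynomial.eval_C,
        Polynomial.eval_prod, ← Finset.prod_mul_distrib]
      simp only [hν, Polynomial.eval_sub, Polynomial.eval_X, Polynomial.eval_C]
    · rw [Polynomial.degree_C_mul hlead, Polynomial.degree_prod]
      simp
    · rw [Polynomial.roots_C_mul _ hlead, hroots, hbroots]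
    · rw [← hblt _ (n / 2 + 1) (by omega) (by omega), hcard]
    · have h1 : ¬ b (n / 2 + 2) < α ^ 2 := by
        rw [← hblt _ (n / 2 + 2) (by omega) (by omega), hcard]
        omega
      -- `3 ≤ n` is needed here: it guarantees a zero above `α²`.
      have hmem : n / 2 + 2 ∈ Finset.Icc 1 n := Finset.mem_Icc.mpr ⟨by omega, by omega⟩
      have h2 : b (n / 2 + 2) ∈ Finset.univ.val.map r := by
        rw [hbroots]
        exact Multiset.mem_map_of_mem b hmem
      obtain ⟨i, -, hi⟩ := Multiset.mem_map.mp h2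
      rw [← hi, hr_lt, not_lt] at h1
      rw [← hi]
      exact hr_gt i (lt_of_le_of_ne h1 (hμ i))
    · intro β hβ
      rw [hindex, ← hpos]
      congr 1
      refine Finset.filter_congr fun i _ => hsign_of_lt β i ?_
      obtain ⟨k, hk, -, hki⟩ := hbr i
      rw [← hki]
      exact hβ.trans_le (hbmono hk)
    · intro β h1 h2
      rw [hindex, Finset.card_eq_zero, Finset.filter_eq_empty_iff]
      intro i _
      obtain ⟨k, hk, hkn, hki⟩ := hbr i
      -- If `μ i > 0`, then `r i` is among the first `n / 2 + 1` zeroes and lies below `β`;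
      -- otherwise it is a later one, above `β`. Either way the eigenvalue is not negative.
      by_cases hi : 0 < μ i
      · rw [hsign_of_gt β i]
        · exact not_lt.mpr hi.le
        · rw [← hr_lt, ← hki, ← hblt _ _ hk hkn, hcard] at hi
          rw [← hki]
          exact (hbmono hi).trans_lt h1
      · rw [hsign_of_lt β i]
        · exact hi
        · rw [← hr_lt, ← hki, ← hblt _ _ hk hkn, hcard, not_le] at hi
          rw [← hki]
          exact h2.trans_le (hbmono hi)
    · intro β hβ
      rw [hindex, ← hneg]
      congr 1
      refine Finset.filter_congr fun i _ => hsign_of_gt β i ?_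
      obtain ⟨k, -, hkn, hki⟩ := hbr i
      rw [← hki]
      exact (hbmono hkn).trans_lt hβ
  · have hν : ∀ β i, c * ((0 : ℝ) ^ 2 + (β - 0 ^ 2) * μ i) = c * μ i * β := by
      intro β i
      ring
    have hdet : ∀ β, (dirichletHessian n 0 β).det = (∏ i, c * μ i) * β ^ n := by
      intro β
      rw [det_of_diagonalization hU (hdiag 0 β)]
      simp only [hν]
      rw [Finset.prod_mul_distrib, Finset.prod_const, Finset.card_univ, Fintype.card_fin]
    refine ⟨Polynomial.C (∏ i, c * μ i) * Polynomial.X ^ n, ?_, ?_, ?_, ?_, ?_, ?_⟩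
    · intro β
      rw [hdet, Polynomial.eval_mul, Polynomial.eval_C, Polynomial.eval_pow, Polynomial.eval_X]
    · exact Polynomial.degree_C_mul_X_pow n hlead
    · intro β
      rw [hdet, mul_eq_zero_iff_left hlead, pow_eq_zero_iff hn0.ne']
    · rw [← Polynomial.count_roots, Polynomial.roots_C_mul_X_pow hlead]
      simp
    · intro β hβ
      rw [hindex, ← hpos]
      congr 1
      refine Finset.filter_congr fun i _ => ?_
      rw [hν, mul_mul_neg_iff_of_neg_right hc hβ]
    · intro β hβ
      rw [hindex, ← hneg]
      congr 1
      refine Finset.filter_congr fun i _ => ?_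
      rw [hν, mul_mul_neg_iff_of_pos_right hc hβ]
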